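/- Let $\alpha\in(0,1)$ and let $S^{(\alpha)}=(S^{(\alpha)}_k)_{k\ge 0}$ be the $\alpha$-skew random walk on $\mathbb Z$ started at $0$, i.e. the Markov chain with $S^{(\alpha)}_0=0$ and one-step transition probabilities $$P\bigl(S^{(\alpha)}_{k+1}=m+1\mid S^{(\alpha)}_k=m\bigr)=\begin{cases}\alpha,&m=0,\\ \tfrac12,&m\neq 0,\end{cases}\qquad P\bigl(S^{(\alpha)}_{k+1}=m-1\mid S^{(\alpha)}_k=m\bigr)=\begin{cases}1-\alpha,&m=0,\\ \tfrac12,&m\neq 0.\end{cases}$$ Let $C(\mathbb R_+,\mathbb R)$ be the space of continuous functions on $\mathbb R_+=[0,\infty)$ with the topology of uniform convergence on compact sets and its Borel $\sigma$-algebra. For each integer $n\ge 1$ let $X^{(\alpha)}_n$ be the rescaled linear interpolation $$X^{(\alpha)}_n(t)=\frac1{\sqrt n}\Bigl(S^{(\alpha)}_{[nt]}+(nt-[nt])\bigl(S^{(\alpha)}_{[nt]+1}-S^{(\alpha)}_{[nt]}\bigr)\Bigr),\qquad t\ge 0,$$ where $[x]$ is the integer part of $x$. Then each $X^{(\alpha)}_n$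 is a random element of $C(\mathbb R_+,\mathbb R)$, and the family $\{X^{(\alpha)}_n : n\ge 1\}$ is tight in $C(\mathbb R_+,\mathbb R)$: for every $\varepsilon>0$ there is a compact set $K\subset C(\mathbb R_+,\mathbb R)$ such that $P\bigl(X^{(\alpha)}_n\notin K\bigr)\le\varepsilon$ for all $n\ge 1$. -/

import Mathlib

open MeasureTheory Set
open scoped NNReal

/-- One-step transition probabilities of the `α`-skew random walk on `ℤ`: from `0` the walk goes
to `1` with probability `α` and to `-1` with probability `1 - α`; from any other site it goes to
each of the two neighbours with probability `1 / 2`. -/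
noncomputable def skewTransition (α : ℝ) (m m' : ℤ) : ℝ :=
  if m' = m + 1 then (if m = 0 then α else 1 / 2)
  else if m' = m - 1 then (if m = 0 then 1 - α else 1 / 2)
  else 0

/-- `S` is an `α`-skew random walk started at `0` on the probability space `(Ω, P)`: a Markov chain
on `ℤ` with `S 0 = 0` and transition probabilities `skewTransition α`. The Markov property is
`P (S (k+1) = y | S 0 = x 0, …, S k = x k) = skewTransition α (x k) y`, with the denominator of the
conditional probability multiplied out. -/
structure IsSkewRandomWalk {Ω : Type*} [MeasurableSpace Ω] (α : ℝ) (P : Measure Ω)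
    (S : ℕ → Ω → ℤ) : Prop where
  measurable : ∀ k, Measurable (S k)
  start : ∀ᵐ ω ∂P, S 0 ω = 0
  markov : ∀ (k : ℕ) (x : ℕ → ℤ) (y : ℤ),
    P.real {ω | (∀ i ≤ k, S i ω = x i) ∧ S (k + 1) ω = y} =
      P.real {ω | ∀ i ≤ k, S i ω = x i} * skewTransition α (x k) y

/-- The linear interpolation of the sequence `s`, at time `u ≥ 0`. -/
noncomputable def linearInterp (s : ℕ → ℤ) (u : ℝ≥0) : ℝ :=
  (s ⌊u⌋₊ : ℝ) + ((u : ℝ) - (⌊u⌋₊ : ℝ)) * ((s (⌊u⌋₊ + 1) : ℝ) - (s ⌊u⌋₊ : ℝ))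

theorem linearInterp_eqOn (s : ℕ → ℤ) (k : ℕ) (u : ℝ≥0) (hu : u ∈ Icc (k : ℝ≥0) (k + 1)) :
    linearInterp s u = (s k : ℝ) + ((u : ℝ) - (k : ℝ)) * ((s (k + 1) : ℝ) - (s k : ℝ)) := by
  rcases eq_or_lt_of_le hu.2 with h | h
  · have hf : ⌊u⌋₊ = k + 1 := by
      rw [h]; exact_mod_cast Nat.floor_natCast (R := ℝ≥0) (k + 1)
    rw [linearInterp, hf, h]
    push_cast
    ring
  · have hf : ⌊u⌋₊ = k := (Nat.floor_eq_iff (zero_le)).2 ⟨hu.1, h⟩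
    rw [linearInterp, hf]

theorem continuous_linearInterp (s : ℕ → ℤ) : Continuous (linearInterp s) := by
  have hlf : LocallyFinite fun k : ℕ => Icc (k : ℝ≥0) (k + 1) := by
    intro t
    refine ⟨Iio (t + 1), Iio_mem_nhds (by simp), (finite_Iic ⌊t + 1⌋₊).subset ?_⟩
    rintro k ⟨u, hu, hut⟩
    exact Nat.le_floor (hu.1.trans (le_of_lt hut))
  refine hlf.continuous ?_ (fun k => isClosed_Icc) ?_
  · refine eq_univ_of_forall fun u => mem_iUnion.2 ⟨⌊u⌋₊, Nat.floor_le (zero_le), ?_⟩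
    exact (Nat.lt_floor_add_one u).le
  · intro k
    refine ContinuousOn.congr (f := fun u : ℝ≥0 =>
      (s k : ℝ) + ((u : ℝ) - (k : ℝ)) * ((s (k + 1) : ℝ) - (s k : ℝ))) ?_
      (fun u hu => linearInterp_eqOn s k u hu)
    fun_prop

/-- The rescaled interpolated path
`t ↦ (1 / √n) (S_[nt] + (nt - [nt]) (S_([nt]+1) - S_[nt]))` of the process `S`,
as a random element of `C(ℝ≥0, ℝ)`. The topology on `C(ℝ≥0, ℝ)` is the compact-open one, that is,
the topology of uniform convergence on compact sets. -/
noncomputable def rescaledWalk {Ω : Type*} (S : ℕ → Ω → ℤ) (n : ℕ) (ω : Ω) : C(ℝ≥0, ℝ) where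
  toFun t := (1 / Real.sqrt n) * linearInterp (fun k => S k ω) ((n : ℝ≥0) * t)
  continuous_toFun := continuous_const.mul
    ((continuous_linearInterp _).comp (continuous_const.mul continuous_id))

/-!
The idea is to turn the walk into a martingale. The scale function `skewScale α`, linear with slope
`1 - α` to the right of the origin and slope `α` to its left, is harmonic for the transition
probabilities, so that `skewScale α (S k)` is a martingale (`martingale_skewScale`). It is
bi-Lipschitz: its increments are at most those of `S`, hence at most `1` per step, and at least
`min α (1 - α)` times those of `S`. Every estimate on this martingale thus transfers to `S`.

A martingale started at `0` with increments bounded by `1` has `E (f m) ^ 4 ≤ 4 * m ^ 2`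
(`Martingale.integral_pow_four_le`), and Doob's maximal inequality for the submartingale `f ^ 4`
gives `P (max_{j ≤ m} |f j| ≥ a) ≤ 4 * m ^ 2 / a ^ 4` (`Martingale.measure_exists_le_abs_le`).

To bound the probability that the rescaled path oscillates by more than `ε` on `[0, N]` over
distances less than `δ`, cut the time interval `[0, n * N]` of the walk into blocks of length
`m = ⌈δ * n⌉`. Such an oscillation forces the walk to move by `ε * √n / 3` within one of the at most
`(N + 1) * n / m` blocks, so its probability is `O(m / n) = O(δ)`, uniformly in `n`
(`measure_oscillatingPaths_le`); when `δ * n < 1` the oscillation is impossible for small `δ`,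
because the path has slopes at most `√n`. By the Arzelà–Ascoli theorem, uniform control of
the oscillations of paths started at `0` is tightness (`isTightMeasureSet_of_oscillatingPaths`).
-/

open scoped ENNReal

/-! ### Martingales with bounded increments -/

section BoundedIncrements

variable {Ω : Type*} {m0 : MeasurableSpace Ω} {μ : Measure Ω}
  {𝓕 : Filtration ℕ m0} {f : ℕ → Ω → ℝ}

/-- The increments of a martingale are orthogonal to bounded functions of the past. -/
theorem MeasureTheory.Martingale.integral_mul_increment_eq_zero [IsFiniteMeasure μ]
    (hf : Martingale f 𝓕 μ) {k : ℕ} {g : Ω → ℝ} (hg : StronglyMeasurable[𝓕 k] g)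
    {C : ℝ} (hC : ∀ᵐ ω ∂μ, |g ω| ≤ C) :
    ∫ ω, g ω * (f (k + 1) ω - f k ω) ∂μ = 0 := by
  have h1 := condExp_stronglyMeasurable_mul_of_bound (𝓕.le k) hg
    ((hf.integrable (k + 1)).sub (hf.integrable k)) C (by simpa using hC)
  have h2 : μ[f (k + 1) - f k | 𝓕 k] =ᵐ[μ] 0 := by
    filter_upwards [condExp_sub (hf.integrable (k + 1)) (hf.integrable k) (𝓕 k),
      hf.2 k (k + 1) k.le_succ, hf.2 k k le_rfl] with ω a b c
    rw [a, Pi.sub_apply, b, c, sub_self, Pi.zero_apply]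
  have h3 := integral_condExp (μ := μ) (f := g * (f (k + 1) - f k)) (𝓕.le k)
  rw [show (∫ ω, g ω * (f (k + 1) ω - f k ω) ∂μ) = ∫ ω, (g * (f (k + 1) - f k)) ω ∂μ from rfl,
    ← h3, integral_eq_zero_of_ae]
  filter_upwards [h1, h2] with ω a b
  rw [a, Pi.mul_apply, b, Pi.zero_apply, mul_zero]

/-- The filtration `j ↦ 𝓕 (k + j)` seen from time `k` on. -/
def MeasureTheory.Filtration.shift (𝓕 : Filtration ℕ m0) (k : ℕ) : Filtration ℕ m0 where
  seq j := 𝓕 (k + j)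
  mono' _ _ h := 𝓕.mono (by gcongr)
  le' _ := 𝓕.le _

theorem MeasureTheory.Martingale.shift [IsFiniteMeasure μ] (hf : Martingale f 𝓕 μ) (k : ℕ) :
    Martingale (fun j ω => f (k + j) ω - f k ω) (𝓕.shift k) μ := by
  refine ⟨fun j => (hf.1 (k + j)).sub ((hf.1 k).mono (𝓕.mono (by simp))), fun i j hij => ?_⟩
  filter_upwards [condExp_sub (hf.integrable (k + j)) (hf.integrable k) (𝓕 (k + i)),
    hf.2 (k + i) (k + j) (by gcongr)] with ω a b
  change (μ[f (k + j) - f k | 𝓕 (k + i)]) ω = _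
  rw [a, Pi.sub_apply, b, condExp_of_stronglyMeasurable (𝓕.le _)
    ((hf.1 k).mono (𝓕.mono (by simp))) (hf.integrable k)]

theorem ae_abs_le_of_bounded_increments (h0 : ∀ᵐ ω ∂μ, f 0 ω = 0)
    (hinc : ∀ k, ∀ᵐ ω ∂μ, |f (k + 1) ω - f k ω| ≤ 1) (k : ℕ) : ∀ᵐ ω ∂μ, |f k ω| ≤ k := by
  induction k with
  | zero => filter_upwards [h0] with ω h; simp [h]
  | succ k ih =>
    filter_upwards [ih, hinc k] with ω a b
    push_cast
    calc |f (k + 1) ω| = |f k ω + (f (k + 1) ω - f k ω)| := by ring_nf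
      _ ≤ _ := (abs_add_le _ _).trans (add_le_add a b)

variable [IsProbabilityMeasure μ] (hf : Martingale f 𝓕 μ) (h0 : ∀ᵐ ω ∂μ, f 0 ω = 0)
  (hinc : ∀ k, ∀ᵐ ω ∂μ, |f (k + 1) ω - f k ω| ≤ 1)

include hf h0 hinc

theorem MeasureTheory.Martingale.integrable_pow (k p : ℕ) :
    Integrable (fun ω => f k ω ^ p) μ := by
  refine Integrable.of_bound ((hf.integrable k).1.pow p) ((k : ℝ) ^ p) ?_
  filter_upwards [ae_abs_le_of_bounded_increments h0 hinc k] with ω h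
  rw [Real.norm_eq_abs, abs_pow]
  gcongr

theorem MeasureTheory.Martingale.integral_pow_mul_increment_eq_zero (k p : ℕ) {s : Set Ω}
    (hs : MeasurableSet[𝓕 k] s) :
    ∫ ω in s, f k ω ^ p * (f (k + 1) ω - f k ω) ∂μ = 0 := by
  rw [← integral_indicator (𝓕.le k _ hs)]
  have h := hf.integral_mul_increment_eq_zero (k := k) (g := s.indicator fun ω => f k ω ^ p)
    (((hf.1 k).pow p).indicator hs) (C := (k : ℝ) ^ p) ?_
  · rw [← h]
    congr 1 with ω
    by_cases hω : ω ∈ s <;> simp [hω]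
  · filter_upwards [ae_abs_le_of_bounded_increments h0 hinc k] with ω h
    by_cases hω : ω ∈ s
    · rw [indicator_of_mem hω, abs_pow]
      gcongr
    · rw [indicator_of_notMem hω, abs_zero]
      positivity

theorem MeasureTheory.Martingale.integrable_pow_mul_increment (k p : ℕ) :
    Integrable (fun ω => f k ω ^ p * (f (k + 1) ω - f k ω)) μ := by
  refine Integrable.mono' (hf.integrable_pow h0 hinc k p).abs
    ((hf.integrable_pow h0 hinc k p).1.mul ((hf.integrable (k + 1)).sub (hf.integrable k)).1) ?_
  filter_upwards [hinc k] with ω h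
  rw [Real.norm_eq_abs, abs_mul]
  exact mul_le_of_le_one_right (abs_nonneg _) h

theorem MeasureTheory.Martingale.integral_sq_le (m : ℕ) : ∫ ω, f m ω ^ 2 ∂μ ≤ m := by
  induction m with
  | zero =>
    rw [integral_eq_zero_of_ae (by filter_upwards [h0] with ω h; simp [h])]
    simp
  | succ k ih =>
    have h2 := hf.integrable_pow h0 hinc k 2
    have hd := (hf.integrable_pow_mul_increment h0 hinc k 1).const_mul 2
    have h2d : Integrable (fun ω => f k ω ^ 2 + 2 * (f k ω ^ 1 * (f (k + 1) ω - f k ω))) μ :=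
      h2.add hd
    have hz := hf.integral_pow_mul_increment_eq_zero h0 hinc k 1 MeasurableSet.univ
    rw [setIntegral_univ] at hz
    calc ∫ ω, f (k + 1) ω ^ 2 ∂μ
        ≤ ∫ ω, (f k ω ^ 2 + 2 * (f k ω ^ 1 * (f (k + 1) ω - f k ω)) + 1) ∂μ := by
          refine integral_mono_ae (hf.integrable_pow h0 hinc (k + 1) 2)
            (h2d.add (integrable_const 1)) ?_
          filter_upwards [hinc k] with ω h
          have := (sq_le_one_iff_abs_le_one _).2 h
          change _ ≤ f k ω ^ 2 + 2 * (f k ω ^ 1 * (f (k + 1) ω - f k ω)) + 1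
          nlinarith
      _ = ∫ ω, f k ω ^ 2 ∂μ + 1 := by
          rw [integral_add h2d (integrable_const 1), integral_add h2 hd,
            integral_const_mul, hz]
          simp
      _ ≤ ((k + 1 : ℕ) : ℝ) := by push_cast; linarith

/-- The fourth moment after `m` steps is of order `m ^ 2`, as for sums of independent variables:
in the expansion of `(f k + d) ^ 4` the term `4 * f k ^ 3 * d` has integral zero, and the others are
controlled by `integral_sq_le`. -/
theorem MeasureTheory.Martingale.integral_pow_four_le (m : ℕ) :
    ∫ ω, f m ω ^ 4 ∂μ ≤ 4 * (m : ℝ) ^ 2 := by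
  induction m with
  | zero =>
    rw [integral_eq_zero_of_ae (by filter_upwards [h0] with ω h; simp [h])]
    simp
  | succ k ih =>
    have h4 := hf.integrable_pow h0 hinc k 4
    have h2 := (hf.integrable_pow h0 hinc k 2).const_mul 8
    have hd := (hf.integrable_pow_mul_increment h0 hinc k 3).const_mul 4
    have h4d : Integrable (fun ω => f k ω ^ 4 + 4 * (f k ω ^ 3 * (f (k + 1) ω - f k ω))) μ :=
      h4.add hd
    have h42 : Integrable (fun ω => f k ω ^ 4 + 4 * (f k ω ^ 3 * (f (k + 1) ω - f k ω))
      + 8 * f k ω ^ 2) μ := h4d.add h2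
    have hz := hf.integral_pow_mul_increment_eq_zero h0 hinc k 3 MeasurableSet.univ
    rw [setIntegral_univ] at hz
    calc ∫ ω, f (k + 1) ω ^ 4 ∂μ
        ≤ ∫ ω, (f k ω ^ 4 + 4 * (f k ω ^ 3 * (f (k + 1) ω - f k ω)) + 8 * f k ω ^ 2 + 3) ∂μ := by
          refine integral_mono_ae (hf.integrable_pow h0 hinc (k + 1) 4)
            (h42.add (integrable_const 3)) ?_
          filter_upwards [hinc k] with ω h
          change _ ≤ f k ω ^ 4 + 4 * (f k ω ^ 3 * (f (k + 1) ω - f k ω)) + 8 * f k ω ^ 2 + 3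
          generalize hy : f k ω = y at *
          obtain ⟨d, hd⟩ : ∃ d, f (k + 1) ω = y + d := ⟨f (k + 1) ω - y, by ring⟩
          rw [hd] at h ⊢
          rw [add_sub_cancel_left] at h ⊢
          have hd2 : d ^ 2 ≤ 1 := (sq_le_one_iff_abs_le_one _).2 h
          -- `4 y d ^ 3 ≤ 2 y ^ 2 + 2` since `|d ^ 3| ≤ 1`
          have hcross : 4 * (y * d ^ 3) ≤ 2 * y ^ 2 + 2 := by
            have : (d ^ 3) ^ 2 ≤ 1 := by
              rw [← pow_mul, mul_comm, pow_mul]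
              exact pow_le_one₀ (sq_nonneg d) hd2
            nlinarith [sq_nonneg (y - d ^ 3)]
          have hsq : y ^ 2 * d ^ 2 ≤ y ^ 2 := mul_le_of_le_one_right (sq_nonneg y) hd2
          have hd4 : d ^ 4 ≤ 1 := by
            rw [show d ^ 4 = (d ^ 2) ^ 2 by ring]
            exact pow_le_one₀ (sq_nonneg d) hd2
          linarith [show (y + d) ^ 4 = y ^ 4 + 4 * (y ^ 3 * d) + 6 * (y ^ 2 * d ^ 2)
            + 4 * (y * d ^ 3) + d ^ 4 by ring]
      _ = ∫ ω, f k ω ^ 4 ∂μ + 8 * ∫ ω, f k ω ^ 2 ∂μ + 3 := by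
          rw [integral_add h42 (integrable_const 3), integral_add h4d h2,
            integral_add h4 hd, integral_const_mul, integral_const_mul, hz]
          simp
      _ ≤ 4 * ((k + 1 : ℕ) : ℝ) ^ 2 := by
          have := hf.integral_sq_le h0 hinc k
          push_cast
          nlinarith

theorem MeasureTheory.Martingale.submartingale_pow_four :
    Submartingale (fun k ω => f k ω ^ 4) 𝓕 μ := by
  refine submartingale_of_setIntegral_le_succ (fun k => (hf.1 k).pow 4)
    (fun k => hf.integrable_pow h0 hinc k 4) fun k s hs => ?_
  have h4 := hf.integrable_pow h0 hinc k 4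
  have hd := (hf.integrable_pow_mul_increment h0 hinc k 3).const_mul 4
  calc ∫ ω in s, f k ω ^ 4 ∂μ
      = ∫ ω in s, (f k ω ^ 4 + 4 * (f k ω ^ 3 * (f (k + 1) ω - f k ω))) ∂μ := by
        rw [integral_add h4.integrableOn hd.integrableOn, integral_const_mul,
          hf.integral_pow_mul_increment_eq_zero h0 hinc k 3 hs]
        simp
    _ ≤ ∫ ω in s, f (k + 1) ω ^ 4 ∂μ := by
        refine integral_mono (h4.add hd).integrableOn
          (hf.integrable_pow h0 hinc (k + 1) 4).integrableOn fun ω => ?_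
        change f k ω ^ 4 + 4 * (f k ω ^ 3 * (f (k + 1) ω - f k ω)) ≤ f (k + 1) ω ^ 4
        -- the graph of `x ↦ x ^ 4` lies above its tangent at `f k ω`
        generalize f k ω = y
        generalize f (k + 1) ω = x
        have h : x ^ 4 - (y ^ 4 + 4 * (y ^ 3 * (x - y)))
            = (x - y) ^ 2 * ((x + y) ^ 2 + 2 * y ^ 2) := by ring
        have : 0 ≤ (x - y) ^ 2 * ((x + y) ^ 2 + 2 * y ^ 2) := by positivity
        linarith

/-- Doob's maximal inequality for the submartingale `f ^ 4`. -/
theorem MeasureTheory.Martingale.measure_exists_le_abs_le (m : ℕ) {a : ℝ} (ha : 0 < a) :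
    μ {ω | ∃ j ≤ m, a ≤ |f j ω|} ≤ ENNReal.ofReal (4 * (m : ℝ) ^ 2 / a ^ 4) := by
  have hmax := maximal_ineq (ε := (a ^ 4).toNNReal) (hf.submartingale_pow_four h0 hinc)
    (fun k ω => by positivity) m
  rw [Real.coe_toNNReal _ (by positivity)] at hmax
  have hsub : {ω | ∃ j ≤ m, a ≤ |f j ω|} ⊆ {ω | a ^ 4 ≤ (Finset.range (m + 1)).sup'
      Finset.nonempty_range_add_one fun k => f k ω ^ 4} := by
    rintro ω ⟨j, hj, hω⟩
    refine Finset.le_sup'_of_le (fun k => f k ω ^ 4) (Finset.mem_range_succ_iff.2 hj) ?_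
    rw [← Even.pow_abs (by decide : Even 4) (f j ω)]
    gcongr
  have hle := (hmax.trans (ENNReal.ofReal_le_ofReal
    ((setIntegral_le_integral (hf.integrable_pow h0 hinc m 4)
      (Filter.Eventually.of_forall fun ω => by positivity)).trans
      (hf.integral_pow_four_le h0 hinc m))))
  rw [ENNReal.ofReal_div_of_pos (by positivity), ENNReal.le_div_iff_mul_le (by simp [ha]) (by simp),
    mul_comm]
  exact (mul_le_mul_right (measure_mono hsub) _).trans hle

end BoundedIncrements

/-! ### The scale function of the skew walk -/

/-- The scale function of the `α`-skew walk: linear with slope `1 - α` on the positive half-line and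
slope `α` on the negative one. It is harmonic for `skewTransition α`. -/
noncomputable def skewScale (α : ℝ) (m : ℤ) : ℝ :=
  if 0 ≤ m then (1 - α) * m else α * m

section Scale

variable {α : ℝ}

theorem skewScale_of_nonneg {m : ℤ} (hm : 0 ≤ m) : skewScale α m = (1 - α) * m := if_pos hm

theorem skewScale_of_nonpos {m : ℤ} (hm : m ≤ 0) : skewScale α m = α * m := by
  rcases hm.eq_or_lt with rfl | h
  · simp [skewScale]
  · exact if_neg (not_le.2 h)

theorem skewScale_harmonic (α : ℝ) (m : ℤ) :
    skewTransition α m (m + 1) * (skewScale α (m + 1) - skewScale α m) +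
      skewTransition α m (m - 1) * (skewScale α (m - 1) - skewScale α m) = 0 := by
  have h1 : m - 1 ≠ m + 1 := by omega
  rcases lt_trichotomy m 0 with h | rfl | h
  · rw [skewScale_of_nonpos (m := m) h.le, skewScale_of_nonpos (m := m + 1) (by omega),
      skewScale_of_nonpos (m := m - 1) (by omega)]
    simp only [skewTransition, if_true, if_neg h.ne, if_neg h1]
    push_cast
    ring
  · rw [skewScale_of_nonneg (m := 0 + 1) (by omega), skewScale_of_nonpos (m := 0 - 1) (by omega),
      skewScale_of_nonneg (m := 0) le_rfl]
    simp [skewTransition]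
    ring
  · rw [skewScale_of_nonneg (m := m) h.le, skewScale_of_nonneg (m := m + 1) (by omega),
      skewScale_of_nonneg (m := m - 1) (by omega)]
    simp only [skewTransition, if_true, if_neg h.ne', if_neg h1]
    push_cast
    ring

theorem skewScale_sub_bounds (hα : α ∈ Ioo (0 : ℝ) 1) {x y : ℤ} (hxy : x ≤ y) :
    min α (1 - α) * ((y : ℝ) - x) ≤ skewScale α y - skewScale α x ∧
      skewScale α y - skewScale α x ≤ (y : ℝ) - x := by
  obtain ⟨h0, h1⟩ := hα
  have hc1 := min_le_left α (1 - α)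
  have hc2 := min_le_right α (1 - α)
  set c := min α (1 - α)
  have hxy' : (x : ℝ) ≤ y := by exact_mod_cast hxy
  rcases le_total 0 x with hx | hx
  · rw [skewScale_of_nonneg hx, skewScale_of_nonneg (hx.trans hxy)]
    constructor <;> nlinarith
  · have hx' : (x : ℝ) ≤ 0 := by exact_mod_cast hx
    rcases le_total 0 y with hy | hy
    · have hy' : (0 : ℝ) ≤ y := by exact_mod_cast hy
      rw [skewScale_of_nonpos hx, skewScale_of_nonneg hy]
      constructor <;> nlinarith
    · rw [skewScale_of_nonpos hx, skewScale_of_nonpos hy]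
      constructor <;> nlinarith

theorem mul_abs_sub_le_abs_skewScale_sub (hα : α ∈ Ioo (0 : ℝ) 1) (x y : ℤ) :
    min α (1 - α) * |(x : ℝ) - y| ≤ |skewScale α x - skewScale α y| := by
  wlog h : x ≤ y generalizing x y
  · rw [abs_sub_comm, abs_sub_comm (skewScale α x)]
    exact this y x (by omega)
  rw [abs_sub_comm, abs_sub_comm (skewScale α x),
    abs_of_nonneg (sub_nonneg.2 (by exact_mod_cast h))]
  exact (skewScale_sub_bounds hα h).1.trans (le_abs_self _)

theorem abs_skewScale_sub_le (hα : α ∈ Ioo (0 : ℝ) 1) (x y : ℤ) :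
    |skewScale α x - skewScale α y| ≤ |(x : ℝ) - y| := by
  wlog h : x ≤ y generalizing x y
  · rw [abs_sub_comm, abs_sub_comm (x : ℝ)]
    exact this y x (by omega)
  have hb := skewScale_sub_bounds hα h
  have hxy : (0 : ℝ) ≤ (y : ℝ) - x := sub_nonneg.2 (by exact_mod_cast h)
  have hc : 0 ≤ min α (1 - α) := le_min hα.1.le (by linarith [hα.2])
  rw [abs_sub_comm, abs_sub_comm (x : ℝ), abs_of_nonneg hxy,
    abs_of_nonneg ((mul_nonneg hc hxy).trans hb.1)]
  exact hb.2

end Scale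

/-! ### The skew walk in its scale is a martingale -/

namespace IsSkewRandomWalk

variable {Ω : Type*} {S : ℕ → Ω → ℤ}

/-- The event that the walk follows the path `z` up to time `k`. -/
def cylinder (S : ℕ → Ω → ℤ) (k : ℕ) (z : Iic k → ℤ) : Set Ω :=
  {ω | (fun i : Iic k => S i ω) = z}

theorem cylinder_apply_last {k : ℕ} {z : Iic k → ℤ} {ω : Ω} (hω : ω ∈ cylinder S k z) :
    S k ω = z ⟨k, self_mem_Iic⟩ :=
  congr_fun hω ⟨k, self_mem_Iic⟩

variable [MeasurableSpace Ω] {α : ℝ} {P : Measure Ω}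

/-- The natural filtration of the walk. -/
noncomputable def filtration (hS : IsSkewRandomWalk α P S) : Filtration ℕ ‹MeasurableSpace Ω› :=
  Filtration.natural S fun k => (hS.measurable k).stronglyMeasurable

theorem measurable_past (hS : IsSkewRandomWalk α P S) (k : ℕ) :
    Measurable fun ω (i : Iic k) => S i ω :=
  measurable_pi_lambda _ fun i => hS.measurable i

theorem measurableSet_cylinder (hS : IsSkewRandomWalk α P S) (k : ℕ) (z : Iic k → ℤ) :
    MeasurableSet (cylinder S k z) :=
  hS.measurable_past k (measurableSet_singleton z)

theorem measureReal_cylinder_inter (hS : IsSkewRandomWalk α P S) (k : ℕ) (z : Iic k → ℤ) (y : ℤ) :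
    P.real (cylinder S k z ∩ {ω | S (k + 1) ω = y}) =
      P.real (cylinder S k z) * skewTransition α (z ⟨k, self_mem_Iic⟩) y := by
  classical
  -- the Markov property is stated for paths on all of `ℕ`; the values after time `k` are irrelevant
  set x : ℕ → ℤ := fun i => if h : i ≤ k then z ⟨i, h⟩ else 0
  have hx : cylinder S k z = {ω | ∀ i ≤ k, S i ω = x i} := by
    ext ω
    simp only [cylinder, mem_ofPred_eq, funext_iff, Subtype.forall, mem_Iic]
    refine forall₂_congr fun i hi => ?_
    simp [x, hi]
  have hk : z ⟨k, self_mem_Iic⟩ = x k := by simp [x]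
  rw [hx, hk, ← hS.markov k x y]
  rfl

theorem measurable_skewScale (hS : IsSkewRandomWalk α P S) (k : ℕ) :
    Measurable fun ω => skewScale α (S k ω) :=
  (measurable_of_countable (skewScale α)).comp (hS.measurable k)

variable [IsProbabilityMeasure P]

theorem ae_step (hS : IsSkewRandomWalk α P S) (k : ℕ) :
    ∀ᵐ ω ∂P, S (k + 1) ω = S k ω + 1 ∨ S (k + 1) ω = S k ω - 1 := by
  have h : ∀ (z : Iic k → ℤ) (y : ℤ), y ≠ z ⟨k, self_mem_Iic⟩ + 1 → y ≠ z ⟨k, self_mem_Iic⟩ - 1 →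
      P (cylinder S k z ∩ {ω | S (k + 1) ω = y}) = 0 := by
    intro z y h1 h2
    rw [← measureReal_eq_zero_iff, hS.measureReal_cylinder_inter]
    simp [skewTransition, h1, h2]
  have h' : ∀ᵐ ω ∂P, ∀ (z : Iic k → ℤ) (y : ℤ), y ≠ z ⟨k, self_mem_Iic⟩ + 1 →
      y ≠ z ⟨k, self_mem_Iic⟩ - 1 → ω ∉ cylinder S k z ∩ {ω | S (k + 1) ω = y} := by
    simp only [ae_all_iff]
    intro z y h1 h2
    exact measure_eq_zero_iff_ae_notMem.1 (h z y h1 h2)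
  filter_upwards [h'] with ω hω
  by_contra! hne
  exact hω _ _ hne.1 hne.2 ⟨rfl, rfl⟩

theorem ae_abs_sub_le (hS : IsSkewRandomWalk α P S) :
    ∀ᵐ ω ∂P, ∀ k, |(S (k + 1) ω : ℝ) - S k ω| ≤ 1 := by
  refine ae_all_iff.2 fun k => ?_
  filter_upwards [hS.ae_step k] with ω h
  rcases h with h | h <;> simp [h]

theorem ae_abs_skewScale_sub_le (hS : IsSkewRandomWalk α P S) (hα : α ∈ Ioo (0 : ℝ) 1) (k : ℕ) :
    ∀ᵐ ω ∂P, |skewScale α (S (k + 1) ω) - skewScale α (S k ω)| ≤ 1 := by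
  filter_upwards [hS.ae_abs_sub_le] with ω h
  exact (abs_skewScale_sub_le hα _ _).trans (h k)

theorem integrable_skewScale (hS : IsSkewRandomWalk α P S) (hα : α ∈ Ioo (0 : ℝ) 1) (k : ℕ) :
    Integrable (fun ω => skewScale α (S k ω)) P := by
  refine Integrable.of_bound (hS.measurable_skewScale k).aestronglyMeasurable (k : ℝ) ?_
  refine ae_abs_le_of_bounded_increments (f := fun k ω => skewScale α (S k ω)) ?_
    (hS.ae_abs_skewScale_sub_le hα) k
  filter_upwards [hS.start] with ω h
  simp [h, skewScale]

theorem setIntegral_cylinder (hS : IsSkewRandomWalk α P S) (k : ℕ) (z : Iic k → ℤ) :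
    ∫ ω in cylinder S k z, (skewScale α (S (k + 1) ω) - skewScale α (S k ω)) ∂P = 0 := by
  set x := z ⟨k, self_mem_Iic⟩ with hx
  set A : ℤ → Set Ω := fun y => cylinder S k z ∩ {ω | S (k + 1) ω = y} with hA
  have hAm : ∀ y, MeasurableSet (A y) := fun y =>
    (hS.measurableSet_cylinder k z).inter (hS.measurable (k + 1) (measurableSet_singleton y))
  have hconst : ∀ y, EqOn (fun ω => skewScale α (S (k + 1) ω) - skewScale α (S k ω))
      (fun _ => skewScale α y - skewScale α x) (A y) := by
    rintro y ω ⟨h1, h2⟩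
    simp only [cylinder_apply_last h1, show S (k + 1) ω = y from h2, hx]
  have hint : ∀ y, IntegrableOn (fun ω => skewScale α (S (k + 1) ω) - skewScale α (S k ω))
      (A y) P := fun y =>
    (integrableOn_congr_fun (hconst y) (hAm y)).2 (integrable_const _).integrableOn
  have hval : ∀ y, ∫ ω in A y, (skewScale α (S (k + 1) ω) - skewScale α (S k ω)) ∂P
      = P.real (cylinder S k z) * (skewTransition α x y * (skewScale α y - skewScale α x)) := by
    intro y
    rw [setIntegral_congr_fun (hAm y) (hconst y), setIntegral_const,
      hS.measureReal_cylinder_inter, smul_eq_mul, mul_assoc]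
  have hunion : cylinder S k z =ᵐ[P] (A (x + 1) ∪ A (x - 1) : Set Ω) := by
    filter_upwards [hS.ae_step k] with ω h
    refine propext ⟨fun hω => ?_, fun hω => hω.elim (fun h => h.1) fun h => h.1⟩
    have := cylinder_apply_last hω
    rcases h with h | h
    · exact Or.inl ⟨hω, h.trans (by rw [this])⟩
    · exact Or.inr ⟨hω, h.trans (by rw [this])⟩
  have hdisj : Disjoint (A (x + 1)) (A (x - 1)) := by
    rw [Set.disjoint_left]
    rintro ω ⟨-, h1⟩ ⟨-, h2⟩
    have h1 : S (k + 1) ω = x + 1 := h1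
    have h2 : S (k + 1) ω = x - 1 := h2
    omega
  rw [setIntegral_congr_set hunion, setIntegral_union hdisj (hAm _) (hint _) (hint _), hval, hval,
    ← mul_add, skewScale_harmonic, mul_zero]

theorem martingale_skewScale (hS : IsSkewRandomWalk α P S) (hα : α ∈ Ioo (0 : ℝ) 1) :
    Martingale (fun k ω => skewScale α (S k ω)) hS.filtration P := by
  refine martingale_of_setIntegral_eq_succ (fun k => ?_) (hS.integrable_skewScale hα)
    fun k s hs => ?_
  · exact ((measurable_of_countable (skewScale α)).comp
      (Filtration.stronglyAdapted_natural
        (fun k => (hS.measurable k).stronglyMeasurable) k).measurable).stronglyMeasurable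
  · have hi : Integrable (fun ω => skewScale α (S (k + 1) ω) - skewScale α (S k ω)) P :=
      (hS.integrable_skewScale hα (k + 1)).sub (hS.integrable_skewScale hα k)
    rw [eq_comm, ← sub_eq_zero, ← integral_sub (hS.integrable_skewScale hα (k + 1)).integrableOn
      (hS.integrable_skewScale hα k).integrableOn]
    rw [filtration, Filtration.natural_eq_comap] at hs
    obtain ⟨B, -, rfl⟩ := hs
    -- an event of the past is a countable union of cylinders
    have hB : (fun ω (i : Iic k) => S i ω) ⁻¹' B = ⋃ z : B, cylinder S k z := by
      ext ω
      simp [cylinder]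
    rw [hB, integral_iUnion (fun z : B => hS.measurableSet_cylinder k z) ?_ hi.integrableOn]
    · simp [hS.setIntegral_cylinder]
    · intro z z' hne
      rw [Function.onFun, Set.disjoint_left]
      intro ω h1 h2
      exact hne (Subtype.ext (h1.symm.trans h2))

/-- The walk moves by at least `a` within `m` steps after time `k` with probability `O(m² / a⁴)`. -/
theorem measure_exists_le_abs_sub_le (hS : IsSkewRandomWalk α P S) (hα : α ∈ Ioo (0 : ℝ) 1)
    (k m : ℕ) {a : ℝ} (ha : 0 < a) :
    P {ω | ∃ j ≤ m, a ≤ |(S (k + j) ω : ℝ) - S k ω|} ≤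
      ENNReal.ofReal (4 * (m : ℝ) ^ 2 / (min α (1 - α) * a) ^ 4) := by
  have hc : 0 < min α (1 - α) := lt_min hα.1 (by linarith [hα.2])
  refine le_trans (measure_mono ?_) (((hS.martingale_skewScale hα).shift k).measure_exists_le_abs_le
    (by simp) (fun j => ?_) m (mul_pos hc ha))
  · rintro ω ⟨j, hj, h⟩
    exact ⟨j, hj, (mul_le_mul_of_nonneg_left h hc.le).trans
      (mul_abs_sub_le_abs_skewScale_sub hα _ _)⟩
  · filter_upwards [hS.ae_abs_skewScale_sub_le hα (k + j)] with ω h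
    simpa [add_assoc] using h

end IsSkewRandomWalk

/-! ### A tightness criterion in `C(ℝ≥0, ℝ)` -/

/-- The paths that oscillate by more than `ε` over two times of `[0, N]` at distance less than
`δ`. -/
def oscillatingPaths (N : ℕ) (δ ε : ℝ) : Set C(ℝ≥0, ℝ) :=
  {f | ∃ s ≤ (N : ℝ≥0), ∃ t ≤ (N : ℝ≥0), dist s t < δ ∧ ε < dist (f s) (f t)}

theorem isOpen_oscillatingPaths (N : ℕ) (δ ε : ℝ) : IsOpen (oscillatingPaths N δ ε) := by
  have h : oscillatingPaths N δ ε = ⋃ s : ℝ≥0, ⋃ _ : s ≤ (N : ℝ≥0), ⋃ t : ℝ≥0,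
      ⋃ _ : t ≤ (N : ℝ≥0), ⋃ _ : dist s t < δ, {f : C(ℝ≥0, ℝ) | ε < dist (f s) (f t)} := by
    ext f
    simp only [oscillatingPaths, mem_iUnion, exists_prop, mem_ofPred_eq]
  rw [h]
  refine isOpen_iUnion fun s => isOpen_iUnion fun _ => isOpen_iUnion fun t =>
    isOpen_iUnion fun _ => isOpen_iUnion fun _ => ?_
  exact isOpen_lt continuous_const
    ((continuous_eval_const s).dist (continuous_eval_const t))

/-- The functions vanishing at `0` with modulus of continuity controlled by `δ`: on `[0, N]`, times
at distance less than `δ N k` have images at distance at most `1 / (k + 1)`. -/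
def controlledFunctions (δ : ℕ → ℕ → ℝ) : Set (ℝ≥0 → ℝ) :=
  {g | g 0 = 0 ∧ ∀ N k : ℕ, ∀ s ≤ (N : ℝ≥0), ∀ t ≤ (N : ℝ≥0), dist s t < δ N k →
    dist (g s) (g t) ≤ 1 / ((k : ℝ) + 1)}

section Tightness

variable {δ : ℕ → ℕ → ℝ}

theorem isClosed_controlledFunctions : IsClosed (controlledFunctions δ) := by
  have h : controlledFunctions δ = {g | g 0 = 0} ∩ ⋂ (N : ℕ) (k : ℕ) (s : ℝ≥0)
      (_ : s ≤ (N : ℝ≥0)) (t : ℝ≥0) (_ : t ≤ (N : ℝ≥0)) (_ : dist s t < δ N k),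
      {g : ℝ≥0 → ℝ | dist (g s) (g t) ≤ 1 / ((k : ℝ) + 1)} := by
    ext g
    simp [controlledFunctions]
  rw [h]
  refine (isClosed_eq (continuous_apply 0) continuous_const).inter ?_
  refine isClosed_iInter fun N => isClosed_iInter fun k => isClosed_iInter fun s =>
    isClosed_iInter fun _ => isClosed_iInter fun t => isClosed_iInter fun _ =>
    isClosed_iInter fun _ => ?_
  exact isClosed_le ((continuous_apply s).dist (continuous_apply t)) continuous_const

theorem exists_abs_le_of_mem_controlledFunctions (hδ : ∀ N k, 0 < δ N k) (t : ℝ≥0) :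
    ∃ B : ℝ, ∀ g ∈ controlledFunctions δ, |g t| ≤ B := by
  obtain ⟨N, hN⟩ := exists_nat_ge t
  obtain ⟨m, hm⟩ := exists_nat_gt ((t : ℝ) / δ N 0)
  have hm0 : (0 : ℝ) < m := lt_of_le_of_lt (div_nonneg t.2 (hδ N 0).le) hm
  have hm0' : (0 : ℝ≥0) < m := by exact_mod_cast hm0
  refine ⟨m, fun g hg => ?_⟩
  -- go from `0` to `t` in `m` steps of length less than `δ N 0`
  have hle : ∀ j ≤ m, (j : ℝ≥0) * (t / m) ≤ N := by
    intro j hj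
    calc (j : ℝ≥0) * (t / m) ≤ m * (t / m) := by gcongr
      _ = t := mul_div_cancel₀ _ hm0'.ne'
      _ ≤ N := hN
  have hstep : ∀ j ≤ m, |g (j * (t / m))| ≤ j := by
    intro j
    induction j with
    | zero => intro _; simp [hg.1]
    | succ j ih =>
      intro hj
      have h := hg.2 N 0 _ (hle (j + 1) hj) _ (hle j (by omega)) ?_
      · rw [Real.dist_eq] at h
        have hi := ih (by omega)
        have := abs_sub_abs_le_abs_sub (g ((j + 1 : ℕ) * (t / m))) (g (j * (t / m)))
        push_cast at *
        norm_num at h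
        linarith
      · rw [NNReal.dist_eq]
        push_cast
        rw [show ((j : ℝ) + 1) * (t / m) - j * (t / m) = t / m by ring,
          abs_of_nonneg (by positivity), div_lt_comm₀ hm0 (hδ N 0)]
        exact hm
  have := hstep m le_rfl
  rwa [mul_div_cancel₀ _ hm0'.ne'] at this

theorem equicontinuous_controlledFunctions (hδ : ∀ N k, 0 < δ N k) :
    Equicontinuous ((↑) : controlledFunctions δ → ℝ≥0 → ℝ) := by
  intro t
  rw [Metric.equicontinuousAt_iff]
  intro ε hε
  obtain ⟨N, hN⟩ := exists_nat_ge (t + 1)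
  obtain ⟨k, hk⟩ := exists_nat_one_div_lt hε
  refine ⟨min 1 (δ N k), lt_min one_pos (hδ N k), fun s hs g => ?_⟩
  have hs' : s ≤ (N : ℝ≥0) := by
    refine le_trans ?_ hN
    have h := hs.trans_le (min_le_left _ _)
    rw [NNReal.dist_eq] at h
    have : (s : ℝ) ≤ t + 1 := by linarith [le_abs_self ((s : ℝ) - t)]
    exact_mod_cast this
  refine lt_of_le_of_lt (g.2.2 N k t ((le_self_add).trans hN) s hs' ?_) hk
  rw [dist_comm]
  exact hs.trans_le (min_le_right _ _)

/-- By the Arzelà–Ascoli theorem. -/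
theorem isCompact_controlledFunctions (hδ : ∀ N k, 0 < δ N k) :
    IsCompact {f : C(ℝ≥0, ℝ) | ⇑f ∈ controlledFunctions δ} := by
  have heq := equicontinuous_controlledFunctions hδ
  refine ArzelaAscoli.isCompact_of_equicontinuous _ ?_ ?_
  · have himage : ContinuousMap.toFun '' {f : C(ℝ≥0, ℝ) | ⇑f ∈ controlledFunctions δ}
        = controlledFunctions δ := by
      ext g
      refine ⟨?_, fun hg => ⟨⟨g, heq.continuous ⟨g, hg⟩⟩, hg, rfl⟩⟩
      rintro ⟨f, hf, rfl⟩
      exact hf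
    rw [himage]
    choose B hB using exists_abs_le_of_mem_controlledFunctions hδ
    refine (isCompact_univ_pi fun t => isCompact_Icc (a := -B t) (b := B t)).of_isClosed_subset
      isClosed_controlledFunctions fun g hg t _ => abs_le.1 (hB t g hg)
  · exact heq.comp fun f : {f : C(ℝ≥0, ℝ) | ⇑f ∈ controlledFunctions δ} =>
      (⟨⇑f.1, f.2⟩ : controlledFunctions δ)

/-- A family of laws on `C(ℝ≥0, ℝ)` starting at `0` is tight as soon as the oscillations over small
intervals are small in probability, uniformly over the family. -/
theorem isTightMeasureSet_of_oscillatingPaths [MeasurableSpace C(ℝ≥0, ℝ)]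
    {T : Set (Measure C(ℝ≥0, ℝ))} (h0 : ∀ μ ∈ T, ∀ᵐ f ∂μ, f 0 = 0)
    (hosc : ∀ (N : ℕ) (ε : ℝ) (η : ℝ≥0), 0 < ε → 0 < η →
      ∃ δ > 0, ∀ μ ∈ T, μ (oscillatingPaths N δ ε) ≤ η) :
    IsTightMeasureSet T := by
  rw [isTightMeasureSet_iff_exists_isCompact_measure_compl_le]
  intro ε hε
  obtain ⟨η, hη, hsum⟩ := ENNReal.exists_pos_sum_of_countable hε.ne' (ℕ × ℕ)
  choose δ hδ hle using fun N k : ℕ =>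
    hosc N (1 / ((k : ℝ) + 1)) (η (N, k)) Nat.one_div_pos_of_nat (hη _)
  refine ⟨_, isCompact_controlledFunctions hδ, fun μ hμ => ?_⟩
  have hsub : {f : C(ℝ≥0, ℝ) | ⇑f ∈ controlledFunctions δ}ᶜ ⊆ {f | ¬ f 0 = 0} ∪
      ⋃ p : ℕ × ℕ, oscillatingPaths p.1 (δ p.1 p.2) (1 / ((p.2 : ℝ) + 1)) := by
    intro f hf
    by_contra h
    rw [mem_union, not_or, mem_iUnion, not_exists] at h
    refine hf ⟨not_not.1 h.1, fun N k s hs t ht hst => ?_⟩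
    by_contra hd
    exact h.2 (N, k) ⟨s, hs, t, ht, hst, not_le.1 hd⟩
  calc μ {f : C(ℝ≥0, ℝ) | ⇑f ∈ controlledFunctions δ}ᶜ
      ≤ μ {f | ¬ f 0 = 0} +
        μ (⋃ p : ℕ × ℕ, oscillatingPaths p.1 (δ p.1 p.2) (1 / ((p.2 : ℝ) + 1))) :=
        (measure_mono hsub).trans (measure_union_le _ _)
    _ ≤ 0 + ∑' p : ℕ × ℕ, (η p : ℝ≥0∞) := by
        gcongr
        · exact (ae_iff.1 (h0 μ hμ)).le
        · exact (measure_iUnion_le _).trans (ENNReal.tsum_le_tsum fun p => hle p.1 p.2 μ hμ)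
    _ ≤ ε := by rw [zero_add]; exact hsum.le

end Tightness

/-! ### Oscillations of the interpolated walk -/

theorem abs_linearInterp_sub_le (s : ℕ → ℤ) (u : ℝ≥0) {a b : ℝ} (h1 : |(s ⌊u⌋₊ : ℝ) - a| ≤ b)
    (h2 : |(s (⌊u⌋₊ + 1) : ℝ) - a| ≤ b) : |linearInterp s u - a| ≤ b := by
  have hθ0 : (0 : ℝ) ≤ (u : ℝ) - (⌊u⌋₊ : ℝ) :=
    sub_nonneg.2 (by exact_mod_cast Nat.floor_le (zero_le (a := u)))
  have hθ1 : (u : ℝ) - (⌊u⌋₊ : ℝ) ≤ 1 := by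
    have : (u : ℝ) < (⌊u⌋₊ : ℝ) + 1 := by exact_mod_cast Nat.lt_floor_add_one u
    linarith
  rw [linearInterp]
  generalize (u : ℝ) - (⌊u⌋₊ : ℝ) = θ at *
  rw [abs_le] at *
  constructor <;> nlinarith

theorem abs_linearInterp_sub_le_abs_sub {s : ℕ → ℤ} (hs : ∀ k, |(s (k + 1) : ℝ) - s k| ≤ 1)
    {u v : ℝ≥0} (huv : u ≤ v) (hvu : v ≤ u + 1) :
    |linearInterp s u - linearInterp s v| ≤ (v : ℝ) - u := by
  have hcell : ∀ (k : ℕ) (u v : ℝ≥0), (k : ℝ≥0) ≤ u → u ≤ v → v ≤ k + 1 →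
      |linearInterp s u - linearInterp s v| ≤ (v : ℝ) - u := by
    intro k u v h1 h2 h3
    have h2' : (u : ℝ) ≤ v := by exact_mod_cast h2
    rw [linearInterp_eqOn s k u ⟨h1, h2.trans h3⟩, linearInterp_eqOn s k v ⟨h1.trans h2, h3⟩,
      add_sub_add_left_eq_sub, ← sub_mul, abs_mul, sub_sub_sub_cancel_right, abs_sub_comm,
      abs_of_nonneg (sub_nonneg.2 h2')]
    exact mul_le_of_le_one_right (sub_nonneg.2 h2') (hs k)
  have hk0 : (⌊u⌋₊ : ℝ≥0) ≤ u := Nat.floor_le (zero_le)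
  have hk1 : u ≤ (⌊u⌋₊ : ℝ≥0) + 1 := (Nat.lt_floor_add_one u).le
  rcases le_total v ((⌊u⌋₊ : ℝ≥0) + 1) with h | h
  · exact hcell _ u v hk0 huv h
  · have ha := hcell _ u _ hk0 hk1 le_rfl
    have hb := hcell (⌊u⌋₊ + 1) ((⌊u⌋₊ : ℝ≥0) + 1) v (by push_cast; rfl) h
      (by push_cast; exact hvu.trans (by gcongr))
    linarith [abs_sub_le (linearInterp s u) (linearInterp s ((⌊u⌋₊ : ℝ≥0) + 1))
      (linearInterp s v)]

/-- If `s` moves by at most `b` within each block of length `m` starting before `M`, then on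
`[0, M]` its interpolation moves by at most `3 * b` over distances up to `m`: such an interval meets
at most two blocks. -/
theorem abs_linearInterp_sub_le_of_blocks {s : ℕ → ℤ} {m M : ℕ} (hm : 0 < m) {b : ℝ}
    (h : ∀ i, i * m ≤ M → ∀ j ≤ m, |(s (i * m + j) : ℝ) - s (i * m)| ≤ b)
    {u v : ℝ≥0} (huv : u ≤ v) (hvu : v ≤ u + m) (hv : v ≤ M) :
    |linearInterp s u - linearInterp s v| ≤ 3 * b := by
  have hblock : ∀ w : ℝ≥0, w ≤ M → |linearInterp s w - s (⌊w⌋₊ / m * m)| ≤ b := by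
    intro w hw
    have hM : ⌊w⌋₊ / m * m ≤ M := (Nat.div_mul_le_self _ _).trans (Nat.floor_le_of_le hw)
    have hdiv := Nat.div_add_mod' ⌊w⌋₊ m
    have hlt := Nat.mod_lt ⌊w⌋₊ hm
    refine abs_linearInterp_sub_le s w ?_ ?_
    · have := h _ hM (⌊w⌋₊ % m) hlt.le
      rwa [hdiv] at this
    · have := h _ hM (⌊w⌋₊ % m + 1) hlt
      rwa [← add_assoc, hdiv] at this
  have hb0 : 0 ≤ b := (abs_nonneg _).trans (hblock 0 (zero_le))
  have hfl : ⌊v⌋₊ ≤ ⌊u⌋₊ + m := by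
    rw [← Nat.floor_add_natCast (zero_le)]
    exact Nat.floor_mono hvu
  have h1 : ⌊u⌋₊ / m ≤ ⌊v⌋₊ / m := Nat.div_le_div_right (Nat.floor_mono huv)
  have h2 : ⌊v⌋₊ / m ≤ ⌊u⌋₊ / m + 1 := by
    rw [← Nat.add_div_right _ hm]
    exact Nat.div_le_div_right hfl
  have hmid : |(s (⌊v⌋₊ / m * m) : ℝ) - s (⌊u⌋₊ / m * m)| ≤ b := by
    rcases (by omega : ⌊v⌋₊ / m = ⌊u⌋₊ / m ∨ ⌊v⌋₊ / m = ⌊u⌋₊ / m + 1) with he | he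
    · simpa [he] using hb0
    · have := h (⌊u⌋₊ / m) ((Nat.div_mul_le_self _ _).trans
        (Nat.floor_le_of_le (huv.trans hv))) m le_rfl
      rwa [he, add_mul, one_mul]
  have hu' := abs_le.1 (hblock u (huv.trans hv))
  have hv' := abs_le.1 (hblock v hv)
  have hm' := abs_le.1 hmid
  rw [abs_le]
  constructor <;> linarith [hu'.1, hu'.2, hv'.1, hv'.2, hm'.1, hm'.2]

section RescaledWalk

variable {Ω : Type*}

theorem dist_rescaledWalk (S : ℕ → Ω → ℤ) (n : ℕ) (ω : Ω) (s t : ℝ≥0) :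
    dist (rescaledWalk S n ω s) (rescaledWalk S n ω t) =
      |linearInterp (fun k => S k ω) (n * s) - linearInterp (fun k => S k ω) (n * t)| /
        Real.sqrt n := by
  rw [Real.dist_eq]
  change |1 / Real.sqrt n * _ - 1 / Real.sqrt n * _| = _
  rw [← mul_sub, abs_mul, abs_of_nonneg (by positivity), one_div_mul_eq_div]

theorem mem_oscillatingPaths_rescaledWalk {S : ℕ → Ω → ℤ} {n N : ℕ} (hn : 1 ≤ n) {δ ε : ℝ} {ω : Ω}
    (h : rescaledWalk S n ω ∈ oscillatingPaths N δ ε) :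
    ∃ u v : ℝ≥0, u ≤ v ∧ v ≤ (n * N : ℕ) ∧ (v : ℝ) - u < δ * n ∧ ε * Real.sqrt n <
      |linearInterp (fun k => S k ω) u - linearInterp (fun k => S k ω) v| := by
  have hn' : (0 : ℝ) < n := by exact_mod_cast hn
  obtain ⟨s, hs, t, ht, hst, hε⟩ := h
  wlog hle : s ≤ t generalizing s t
  · exact this t ht s hs (by rwa [dist_comm]) (by rwa [dist_comm]) (le_of_not_ge hle)
  rw [dist_rescaledWalk, lt_div_iff₀ (Real.sqrt_pos.2 hn')] at hε
  refine ⟨n * s, n * t, by gcongr, by push_cast; gcongr, ?_, hε⟩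
  rw [dist_comm, NNReal.dist_eq] at hst
  push_cast
  nlinarith [le_abs_self ((t : ℝ) - s)]

theorem measurable_rescaledWalk [MeasurableSpace C(ℝ≥0, ℝ)] [BorelSpace C(ℝ≥0, ℝ)]
    [MeasurableSpace Ω] {S : ℕ → Ω → ℤ} (hS : ∀ k, Measurable (S k)) (n : ℕ) :
    Measurable (rescaledWalk S n) := by
  have hcont : Continuous (rescaledWalk (fun k (s : ℕ → ℤ) => s k) n) := by
    refine ContinuousMap.continuous_of_continuous_uncurry _ ?_
    rw [continuous_iff_continuousAt]
    rintro ⟨s, t⟩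
    -- near `(s, t)` the interpolation only depends on finitely many coordinates of the path
    obtain ⟨K, hK⟩ := exists_nat_gt ((n : ℝ≥0) * t)
    have hs : ∀ᶠ p : (ℕ → ℤ) × ℝ≥0 in nhds (s, t), ∀ k ∈ Finset.range (K + 1), p.1 k = s k := by
      rw [Filter.eventually_all_finset]
      intro k _
      have hk : Continuous fun p : (ℕ → ℤ) × ℝ≥0 => p.1 k :=
        (continuous_apply k).comp continuous_fst
      exact (hk.tendsto (s, t)).eventually (by simp : ∀ᶠ y in nhds (s k), y = s k)
    have ht : ∀ᶠ p : (ℕ → ℤ) × ℝ≥0 in nhds (s, t), (n : ℝ≥0) * p.2 < K :=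
      (continuous_const.mul continuous_snd).continuousAt.eventually_lt continuousAt_const hK
    refine ((rescaledWalk (fun k (s : ℕ → ℤ) => s k) n s).continuous.comp
      continuous_snd).continuousAt.congr ?_
    filter_upwards [hs, ht] with p hp1 hp2
    have hfl : ⌊(n : ℝ≥0) * p.2⌋₊ < K := (Nat.floor_lt (zero_le)).2 hp2
    change 1 / Real.sqrt n * linearInterp s (n * p.2) =
      1 / Real.sqrt n * linearInterp p.1 (n * p.2)
    rw [linearInterp, linearInterp, hp1 _ (by simp; omega), hp1 _ (by simp; omega)]
  exact hcont.measurable.comp (measurable_pi_lambda _ hS)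

namespace IsSkewRandomWalk

variable [MeasurableSpace Ω] {α : ℝ} {P : Measure Ω} [IsProbabilityMeasure P] {S : ℕ → Ω → ℤ}

theorem measure_oscillatingPaths_le (hS : IsSkewRandomWalk α P S) (hα : α ∈ Ioo (0 : ℝ) 1)
    {n : ℕ} (hn : 1 ≤ n) (N : ℕ) {δ ε : ℝ} (hδ0 : 0 < δ) (hδ1 : δ ≤ 1) (hε : 0 < ε)
    (hδε : δ ≤ ε ^ 2) :
    P {ω | rescaledWalk S n ω ∈ oscillatingPaths N δ ε} ≤
      ENNReal.ofReal (648 * (N + 1) / (min α (1 - α) * ε) ^ 4 * δ) := by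
  have hn' : (0 : ℝ) < n := by exact_mod_cast hn
  have hc : 0 < min α (1 - α) := lt_min hα.1 (by linarith [hα.2])
  set c := min α (1 - α)
  rcases lt_or_ge (δ * n) 1 with hlt | hge
  · -- here the oscillation is at most `δ * √n ≤ √δ ≤ ε`, because the path moves by single steps
    refine le_of_eq_of_le ?_ (zero_le)
    rw [measure_eq_zero_iff_ae_notMem]
    filter_upwards [hS.ae_abs_sub_le] with ω hω hmem
    obtain ⟨u, v, huv, -, hd, hosc⟩ := mem_oscillatingPaths_rescaledWalk hn hmem
    have hvu : v ≤ u + 1 := by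
      have : (v : ℝ) ≤ u + 1 := by linarith
      exact_mod_cast this
    have hle := abs_linearInterp_sub_le_abs_sub (s := fun k => S k ω) hω huv hvu
    have hsq : (δ * n) ^ 2 ≤ (ε * Real.sqrt n) ^ 2 := by
      rw [mul_pow ε, Real.sq_sqrt hn'.le]
      calc (δ * n) ^ 2 = (δ * n) * (δ * n) := by ring
        _ ≤ 1 * (ε ^ 2 * n) := by gcongr
        _ = _ := one_mul _
    have := (sq_le_sq₀ (by positivity) (by positivity)).1 hsq
    linarith
  · set m := ⌈δ * n⌉₊ with hm
    have hm1 : δ * n ≤ m := Nat.le_ceil _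
    have hm2 : (m : ℝ) ≤ 2 * (δ * n) := by
      linarith [Nat.ceil_lt_add_one (by positivity : 0 ≤ δ * n)]
    have hm0' : (0 : ℝ) < m := by linarith
    have hm0 : 0 < m := by exact_mod_cast hm0'
    have hmn : (m : ℝ) ≤ n := by
      exact_mod_cast Nat.ceil_le.2 (mul_le_of_le_one_left hn'.le hδ1)
    set a := ε * Real.sqrt n / 3 with ha
    have ha0 : 0 < a := by positivity
    have hsub : {ω | rescaledWalk S n ω ∈ oscillatingPaths N δ ε} ⊆
        ⋃ i ∈ Finset.range (n * N / m + 1),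
          {ω | ∃ j ≤ m, a ≤ |(S (i * m + j) ω : ℝ) - S (i * m) ω|} := by
      intro ω hω
      obtain ⟨u, v, huv, hv, hd, hosc⟩ := mem_oscillatingPaths_rescaledWalk hn hω
      by_contra hnot
      simp only [mem_iUnion, mem_ofPred_eq, not_exists, not_and, not_le, Finset.mem_range] at hnot
      have hvu : v ≤ u + m := by
        have : (v : ℝ) ≤ u + m := by linarith
        exact_mod_cast this
      have := abs_linearInterp_sub_le_of_blocks (s := fun k => S k ω) hm0 (b := a)
        (fun i hi j hj => (hnot i (Nat.lt_succ_of_le ((Nat.le_div_iff_mul_le hm0).2 hi)) j hj).le)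
        huv hvu hv
      linarith
    have hcount : ((n * N / m + 1 : ℕ) : ℝ) ≤ (N + 1) * (n / m) := by
      have h1 : ((n * N / m : ℕ) : ℝ) ≤ (n * N : ℕ) / m := Nat.cast_div_le
      have h2 : 1 ≤ (n : ℝ) / m := (one_le_div hm0').2 hmn
      push_cast at h1 ⊢
      calc ((n * N / m : ℕ) : ℝ) + 1 ≤ n * N / m + n / m := add_le_add h1 h2
        _ = _ := by ring
    have ha4 : (c * a) ^ 4 = (c * ε) ^ 4 * n ^ 2 / 81 := by
      rw [ha, show (c * (ε * Real.sqrt n / 3)) ^ 4 =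
        (c * ε) ^ 4 * (Real.sqrt n ^ 2) ^ 2 / 81 by ring,
        Real.sq_sqrt hn'.le]
    calc P {ω | rescaledWalk S n ω ∈ oscillatingPaths N δ ε}
        ≤ ∑ i ∈ Finset.range (n * N / m + 1),
            P {ω | ∃ j ≤ m, a ≤ |(S (i * m + j) ω : ℝ) - S (i * m) ω|} :=
          (measure_mono hsub).trans (measure_biUnion_finset_le _ _)
      _ ≤ ∑ i ∈ Finset.range (n * N / m + 1), ENNReal.ofReal (4 * (m : ℝ) ^ 2 / (c * a) ^ 4) :=
          Finset.sum_le_sum fun i _ => hS.measure_exists_le_abs_sub_le hα (i * m) m ha0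
      _ = ENNReal.ofReal ((n * N / m + 1 : ℕ) * (4 * (m : ℝ) ^ 2 / (c * a) ^ 4)) := by
          rw [Finset.sum_const, Finset.card_range, nsmul_eq_mul,
            ENNReal.ofReal_mul (Nat.cast_nonneg _), ENNReal.ofReal_natCast]
      _ ≤ ENNReal.ofReal (648 * (N + 1) / (c * ε) ^ 4 * δ) := by
          refine ENNReal.ofReal_le_ofReal ?_
          calc ((n * N / m + 1 : ℕ) : ℝ) * (4 * (m : ℝ) ^ 2 / (c * a) ^ 4)
              ≤ (N + 1) * (n / m) * (4 * (m : ℝ) ^ 2 / (c * a) ^ 4) := by gcongr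
            _ = 324 * (N + 1) / ((c * ε) ^ 4 * n) * m := by
                rw [ha4]
                field_simp
                ring
            _ ≤ 324 * (N + 1) / ((c * ε) ^ 4 * n) * (2 * (δ * n)) := by gcongr
            _ = 648 * (N + 1) / (c * ε) ^ 4 * δ := by
                field_simp
                ring

end IsSkewRandomWalk

end RescaledWalk

theorem mainTheorem2 [MeasurableSpace C(ℝ≥0, ℝ)] [BorelSpace C(ℝ≥0, ℝ)]
    (α : ℝ) (hα : α ∈ Set.Ioo (0 : ℝ) 1)
    {Ω : Type*} [MeasurableSpace Ω] (P : Measure Ω) [IsProbabilityMeasure P]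
    (S : ℕ → Ω → ℤ) (hS : IsSkewRandomWalk α P S) :
    (∀ n : ℕ, 1 ≤ n → Measurable (rescaledWalk S n)) ∧
      IsTightMeasureSet {μ : Measure C(ℝ≥0, ℝ) | ∃ n : ℕ, 1 ≤ n ∧ μ = P.map (rescaledWalk S n)} := by
  have hmeas := measurable_rescaledWalk hS.measurable
  refine ⟨fun n _ => hmeas n, isTightMeasureSet_of_oscillatingPaths ?_ fun N ε η hε hη => ?_⟩
  · rintro _ ⟨n, -, rfl⟩
    rw [ae_map_iff (hmeas n).aemeasurable (isClosed_eq
      (continuous_eval_const 0) continuous_const).measurableSet]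
    filter_upwards [hS.start] with ω h
    change 1 / Real.sqrt n * linearInterp (fun k => S k ω) (n * 0) = 0
    simp [linearInterp, h]
  · have hc : 0 < min α (1 - α) := lt_min hα.1 (by linarith [hα.2])
    set C := 648 * ((N : ℝ) + 1) / (min α (1 - α) * ε) ^ 4 with hC
    have hC0 : 0 < C := by positivity
    have hη' : (0 : ℝ) < η := hη
    refine ⟨min (min 1 (ε ^ 2)) (η / C), by positivity, ?_⟩
    rintro _ ⟨n, hn, rfl⟩
    rw [Measure.map_apply (hmeas n) (isOpen_oscillatingPaths _ _ _).measurableSet]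
    refine (hS.measure_oscillatingPaths_le hα hn N (by positivity)
      ((min_le_left _ _).trans (min_le_left _ _)) hε
      ((min_le_left _ _).trans (min_le_right _ _))).trans ?_
    rw [← ENNReal.ofReal_coe_nnreal]
    refine ENNReal.ofReal_le_ofReal ?_
    calc C * min (min 1 (ε ^ 2)) (η / C) ≤ C * (η / C) := by gcongr; exact min_le_right _ _
      _ = η := mul_div_cancel₀ _ hC0.ne'
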